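/- Let $k$ be a field, let $R$ be a (left and right) noetherian $k$-algebra, and let $G$ be a finite group acting on $R$ by $k$-algebra automorphisms, with $|G|$ invertible in $k$. Let $A=R^G$ be the invariant subalgebra and let $B=R*G$ be the skew group algebra, with multiplication $(rg)(sh)=r(g\cdot s)\,gh$. View $R$ as a $B$-$A$-bimodule via $(rg)\cdot x=r(g\cdot x)$ and right multiplication by $A$. Let $\mathfrak r\subseteq R$ be the two-sided ideal of all sums $\sum_{i=1}^n a_ib_i$ $(n\ge 1)$, where $a_i,b_i\in R$ satisfy $\sum_{i=1}^n a_i(g\cdot b_i)=0$ for every $1\neq g\in G$. Put $\mathfrak a=\mathfrak r\cap A$ and $\mathfrak b=\mathfrak r\otimes kG=\{\sum_g r_g g : r_g\in\mathfrak r\}\subseteq B$; these are two-sided ideals of $A$ and $B$. For a right noetherian ring $S$ with a two-sided ideal $\mathfrak s$, a right $S$-module $M$ is $\mathfrak s$-torsion if for every $x\in M$ there is $n$ with $x\mathfrak s^n=0$. Let $\operatorname{QMod}_{\mathfrak s}S=\operatorname{Mod}S/\operatorname{Tor}_{\mathfrak s}S$ be the quotient of the category of right $S$-modules by the Serre subcategory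 of $\mathfrak s$-torsion modules, that is, its localization at the morphisms with $\mathfrak s$-torsion kernel and cokernel. Assume * $\mathfrak a$ and $\mathfrak r$ are cofinal: $\mathfrak aR=R\mathfrak a$, and for each $s\ge 0$ there is $n$ with $\mathfrak r^n\subseteq\mathfrak a^sR$; * $\mathfrak a$ has the right Artin–Rees property: for every right ideal $J$ of $A$ there is $n$ with $J\cap\mathfrak a^n\subseteq J\mathfrak a$. Then: 1. The functor $\operatorname{Hom}_A(R,-):\operatorname{Mod}A\to\operatorname{Mod}B$ sends morphisms with $\mathfrak a$-torsion kernel and cokernel to morphisms with $\mathfrak b$-torsion kernel and cokernel, and hence induces a functor $\operatorname{QMod}_{\mathfrak a}A\to\operatorname{QMod}_{\mathfrak b}B$. 2. The functor $-\otimes_BR:\operatorname{Mod}B\to\operatorname{Mod}A$ likewise induces a functor $\operatorname{QMod}_{\mathfrak b}B\to\operatorname{QMod}_{\mathfrak a}A$, and the two induced functors are quasi-inverse to each other: both composites are naturally isomorphic to the identity functors. In particular they are equivalences of categories. -/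

import Mathlib

open CategoryTheory MulOpposite
open scoped TensorProduct

universe u

set_option linter.unusedSectionVars false

noncomputable section

/-! Right modules over a ring `S` are left modules over `Sᵐᵒᵖ`; the right action of `s` on `m` is
`op s • m`.  Two-sided ideals are `Ideal`s with `Ideal.IsTwoSided`, so that `I ^ n` is the usual
power. -/

namespace RightTorsion

section Torsion

variable (S : Type u) [Ring S] (I : Ideal S)

/-- The `I`-torsion right `S`-modules: each element `x` satisfies `x I ^ n = 0` for some `n`. -/
def torsion : ObjectProperty (ModuleCat.{u} Sᵐᵒᵖ) :=
  fun M => ∀ x : M, ∃ n : ℕ, ∀ s ∈ I ^ n, op s • x = 0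

/-- Over a right noetherian ring, the torsion modules form a Serre class. -/
instance [IsNoetherianRing Sᵐᵒᵖ] [I.IsTwoSided] : (torsion S I).IsSerreClass where
  exists_zero := ⟨.of _ PUnit, ModuleCat.isZero_of_subsingleton _, fun x => ⟨0, fun _ _ => rfl⟩⟩
  prop_of_mono {M N} f hf hN x := by
    rw [ModuleCat.mono_iff_injective] at hf
    obtain ⟨n, hn⟩ := hN (f x)
    refine ⟨n, fun s hs => hf ?_⟩
    rw [map_zero, map_smul]
    exact hn s hs
  prop_of_epi {M N} f hf hM y := by
    rw [ModuleCat.epi_iff_surjective] at hf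
    obtain ⟨x, rfl⟩ := hf y
    obtain ⟨n, hn⟩ := hM x
    refine ⟨n, fun s hs => ?_⟩
    rw [← map_smul, hn s hs, map_zero]
  prop_X₂_of_shortExact {C} hC h₁ h₃ x := by
    obtain ⟨n, hn⟩ := h₃ (C.g x)
    -- the right ideal `I ^ n` is finitely generated
    let J : Ideal Sᵐᵒᵖ :=
      { carrier := {a | a.unop ∈ I ^ n}
        add_mem' := fun ha hb => (I ^ n).add_mem ha hb
        zero_mem' := (I ^ n).zero_mem
        smul_mem' := fun c a ha => (I ^ n).mul_mem_right c.unop ha }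
    obtain ⟨F, hF⟩ := J.fg_of_isNoetherianRing
    have hFJ : ∀ a ∈ F, a ∈ J := fun a ha => hF ▸ Submodule.subset_span ha
    have hkill : ∀ a : Sᵐᵒᵖ, ∃ m : ℕ, a ∈ F → ∀ s ∈ I ^ m, op s • a • x = 0 := by
      intro a
      by_cases ha : a ∈ F
      · obtain ⟨y, hy⟩ := (ShortComplex.moduleCat_exact_iff C).1 hC.exact (a • x)
          (by rw [map_smul]; exact hn a.unop (hFJ a ha))
        obtain ⟨m, hm⟩ := h₁ y
        refine ⟨m, fun _ s hs => ?_⟩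
        rw [← hy, ← map_smul, hm s hs, map_zero]
      · exact ⟨0, fun h => absurd h ha⟩
    choose m hm using hkill
    let N := F.sup m
    refine ⟨n + N, fun s hs => ?_⟩
    have key : ∀ a ∈ J, ∀ t ∈ I ^ N, op t • a • x = 0 := by
      intro a ha
      rw [← hF] at ha
      induction ha using Submodule.span_induction with
      | mem a ha => exact fun t ht => hm a ha t (Ideal.pow_le_pow_right (Finset.le_sup ha) ht)
      | zero => intro t _; simp
      | add a b _ _ ha hb => intro t ht; rw [add_smul, smul_add, ha t ht, hb t ht, add_zero]
      | smul c a _ ha =>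
        intro t ht
        have : op t • (c • a) • x = op (c.unop * t) • a • x := by
          simp only [smul_smul, smul_eq_mul, op_mul, op_unop, mul_assoc]
        rw [this]
        exact ha _ ((I ^ N).mul_mem_left _ ht)
    rw [Ideal.IsTwoSided.pow_add] at hs
    induction hs using Submodule.mul_induction_on' with
    | mem_mul_mem a ha t ht =>
      rw [op_mul, mul_smul]
      exact key (op a) ha t ht
    | add a _ b _ ha hb => rw [MulOpposite.op_add, add_smul, ha, hb, add_zero]

/-- The morphisms of right `S`-modules whose kernel and cokernel are `I`-torsion. -/
abbrev isoModTorsion [IsNoetherianRing Sᵐᵒᵖ] [I.IsTwoSided] :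
    MorphismProperty (ModuleCat.{u} Sᵐᵒᵖ) :=
  (torsion S I).isoModSerre

/-- The quotient category `Mod S / Tor_I S`: the localization of `Mod S` at the morphisms with
`I`-torsion kernel and cokernel. -/
abbrev QMod [IsNoetherianRing Sᵐᵒᵖ] [I.IsTwoSided] := (isoModTorsion S I).Localization

/-- The projection functor `Mod S ⥤ QMod_I S`. -/
abbrev projQMod [IsNoetherianRing Sᵐᵒᵖ] [I.IsTwoSided] : ModuleCat.{u} Sᵐᵒᵖ ⥤ QMod S I :=
  (isoModTorsion S I).Q

/-- The right Artin-Rees property: for each right ideal `J` there is `n` with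
`J ∩ I ^ n ⊆ J I`. -/
def HasRightAR : Prop :=
  ∀ J : Submodule Sᵐᵒᵖ S, ∃ n : ℕ, ∀ x ∈ J, x ∈ I ^ n →
    x ∈ Submodule.span Sᵐᵒᵖ {y : S | ∃ j ∈ J, ∃ a ∈ I, y = j * a}

end Torsion

section Bimodule

variable (S T : Type u) [Ring S] [Ring T] (P : Type u) [AddCommGroup P]
  [Module S P] [Module Tᵐᵒᵖ P] [SMulCommClass S Tᵐᵒᵖ P]

section Hom

/-- `Hom_T(P, N)` for an `S`-`T`-bimodule `P` and a right `T`-module `N`, as a type that carries a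
right `S`-module structure. -/
@[nolint unusedArguments]
def BimodHom (_S T : Type u) [Ring T] (P : Type u) [AddCommGroup P] [Module Tᵐᵒᵖ P]
    (N : Type u) [AddCommGroup N] [Module Tᵐᵒᵖ N] : Type u := P →ₗ[Tᵐᵒᵖ] N

variable (N : Type u) [AddCommGroup N] [Module Tᵐᵒᵖ N]

instance : AddCommGroup (BimodHom S T P N) := inferInstanceAs (AddCommGroup (P →ₗ[Tᵐᵒᵖ] N))

instance : FunLike (BimodHom S T P N) P N := inferInstanceAs (FunLike (P →ₗ[Tᵐᵒᵖ] N) P N)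

variable {S T P N}

/-- An element of `BimodHom S T P N` as a linear map. -/
def BimodHom.toLin (f : BimodHom S T P N) : P →ₗ[Tᵐᵒᵖ] N := f

theorem BimodHom.ext {f g : BimodHom S T P N} (h : ∀ p, f p = g p) : f = g := DFunLike.ext _ _ h

theorem BimodHom.add_apply (f g : BimodHom S T P N) (p : P) : (f + g) p = f p + g p := rfl

theorem BimodHom.zero_apply (p : P) : (0 : BimodHom S T P N) p = 0 := rfl

theorem BimodHom.map_add (f : BimodHom S T P N) (p q : P) : f (p + q) = f p + f q :=
  LinearMap.map_add f.toLin p q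

theorem BimodHom.map_zero (f : BimodHom S T P N) : f 0 = 0 := LinearMap.map_zero f.toLin

/-- The right action of `S` on `Hom_T(P, N)` is `(f · s)(p) = f (s • p)`. -/
instance : SMul Sᵐᵒᵖ (BimodHom S T P N) where
  smul s f := LinearMap.comp f.toLin (DistribSMul.toLinearMap Tᵐᵒᵖ P s.unop)

theorem BimodHom.smul_apply (s : Sᵐᵒᵖ) (f : BimodHom S T P N) (p : P) :
    (s • f) p = f (s.unop • p) := rfl

instance : Module Sᵐᵒᵖ (BimodHom S T P N) where
  one_smul f := BimodHom.ext fun p => by rw [BimodHom.smul_apply, unop_one, one_smul]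
  mul_smul s t f := BimodHom.ext fun p => by simp only [BimodHom.smul_apply, unop_mul, mul_smul]
  smul_zero _ := rfl
  smul_add _ _ _ := rfl
  add_smul s t f := BimodHom.ext fun p => by
    simp only [BimodHom.smul_apply, BimodHom.add_apply, MulOpposite.unop_add, add_smul,
      BimodHom.map_add]
  zero_smul f := BimodHom.ext fun p => by
    rw [BimodHom.smul_apply, MulOpposite.unop_zero, zero_smul, BimodHom.map_zero,
      BimodHom.zero_apply]

variable (S T P)

/-- Post-composition with `f : N → N'` as a map of right `S`-modules. -/
def BimodHom.map {N' : Type u} [AddCommGroup N'] [Module Tᵐᵒᵖ N'] (f : N →ₗ[Tᵐᵒᵖ] N') :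
    BimodHom S T P N →ₗ[Sᵐᵒᵖ] BimodHom S T P N' where
  toFun φ := LinearMap.comp f φ.toLin
  map_add' φ ψ := BimodHom.ext fun p => LinearMap.map_add f (φ p) (ψ p)
  map_smul' _ _ := rfl

end Hom

/-- The functor `Hom_T(P, -) : Mod T ⥤ Mod S`. -/
def homFunctor : ModuleCat.{u} Tᵐᵒᵖ ⥤ ModuleCat.{u} Sᵐᵒᵖ where
  obj N := ModuleCat.of Sᵐᵒᵖ (BimodHom S T P N)
  map f := ModuleCat.ofHom (BimodHom.map S T P f.hom)
  map_id _ := rfl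
  map_comp _ _ := rfl

section Tensor

variable (M : Type u) [AddCommGroup M] [Module Sᵐᵒᵖ M]

/-- The relations `m s ⊗ p = m ⊗ s p` of the tensor product `M ⊗_S P`.  The two factors are written
in the order `p ⊗ m`, so that the right action of `T` on `P` is the one Mathlib puts on
`P ⊗[ℤ] M`. -/
def tensorRel : Submodule Tᵐᵒᵖ (P ⊗[ℤ] M) :=
  Submodule.span Tᵐᵒᵖ {z | ∃ (m : M) (s : S) (p : P), z = p ⊗ₜ (op s • m) - (s • p) ⊗ₜ m}

/-- The tensor product `M ⊗_S P` of a right `S`-module `M` with an `S`-`T`-bimodule `P`, as a right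
`T`-module. -/
abbrev BimodTensor : Type u := (P ⊗[ℤ] M) ⧸ tensorRel S T P M

variable {M} {M' : Type u} [AddCommGroup M'] [Module Sᵐᵒᵖ M']

/-- The map `f ⊗ P : M ⊗_S P → M' ⊗_S P`. -/
def BimodTensor.map (f : M →ₗ[Sᵐᵒᵖ] M') :
    BimodTensor S T P M →ₗ[Tᵐᵒᵖ] BimodTensor S T P M' :=
  Submodule.mapQ _ _
    (TensorProduct.AlgebraTensorModule.map (LinearMap.id : P →ₗ[Tᵐᵒᵖ] P)
      (f.toAddMonoidHom.toIntLinearMap)) <| by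
    rw [tensorRel, Submodule.span_le]
    rintro _ ⟨m, s, p, rfl⟩
    refine Submodule.subset_span ⟨f m, s, p, ?_⟩
    simp

end Tensor

/-- The functor `- ⊗_S P : Mod S ⥤ Mod T`. -/
def tensorFunctor : ModuleCat.{u} Sᵐᵒᵖ ⥤ ModuleCat.{u} Tᵐᵒᵖ where
  obj M := ModuleCat.of Tᵐᵒᵖ (BimodTensor S T P M)
  map f := ModuleCat.ofHom (BimodTensor.map S T P f.hom)
  map_id M := by
    refine ModuleCat.hom_ext (LinearMap.ext fun x => ?_)
    obtain ⟨x, rfl⟩ := Submodule.mkQ_surjective _ x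
    induction x using TensorProduct.induction_on with
    | zero => simp
    | tmul p m => rfl
    | add x y hx hy => rw [map_add, map_add, hx, hy, map_add]
  map_comp f g := by
    refine ModuleCat.hom_ext (LinearMap.ext fun x => ?_)
    obtain ⟨x, rfl⟩ := Submodule.mkQ_surjective _ x
    induction x using TensorProduct.induction_on with
    | zero => simp
    | tmul p m => rfl
    | add x y hx hy => rw [map_add, map_add, hx, hy, map_add]

end Bimodule

section GroupAction

variable (k R G : Type u) [Field k] [Ring R] [Algebra k R] [Group G] [MulSemiringAction G R]

/-- The sequences `a` and `b` of elements of `R` are pertinent under the `G`-action: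
`∑ aᵢ (g · bᵢ) = 0` for all `g ≠ 1`. -/
def Pertinent {n : ℕ} (a b : Fin n → R) : Prop :=
  ∀ g : G, g ≠ 1 → ∑ i, a i * (g • b i) = 0

/-- The `G`-radical of `R`: the ideal of all sums `∑ aᵢ bᵢ` over pertinent sequences. -/
def gRadical : Ideal R where
  carrier := {x | ∃ (n : ℕ) (a b : Fin n → R), 1 ≤ n ∧ Pertinent R G a b ∧ x = ∑ i, a i * b i}
  add_mem' := by
    rintro _ _ ⟨n, a, b, hn, hab, rfl⟩ ⟨m, a', b', -, hab', rfl⟩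
    refine ⟨n + m, Fin.append a a', Fin.append b b', by omega, fun g hg => ?_, ?_⟩
    · simp [Fin.sum_univ_add, hab g hg, hab' g hg]
    · simp [Fin.sum_univ_add]
  zero_mem' := ⟨1, 0, 0, le_rfl, fun g _ => by simp, by simp⟩
  smul_mem' := by
    rintro c _ ⟨n, a, b, hn, hab, rfl⟩
    refine ⟨n, fun i => c * a i, b, hn, fun g hg => ?_, ?_⟩
    · simp only [mul_assoc, ← Finset.mul_sum, hab g hg, mul_zero]
    · simp only [mul_assoc, ← Finset.mul_sum, smul_eq_mul]

instance : (gRadical R G).IsTwoSided where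
  mul_mem_of_left := by
    rintro _ c ⟨n, a, b, hn, hab, rfl⟩
    refine ⟨n, a, fun i => b i * c, hn, fun g hg => ?_, ?_⟩
    · simp only [smul_mul', ← mul_assoc, ← Finset.sum_mul, hab g hg, zero_mul]
    · simp only [← mul_assoc, ← Finset.sum_mul]

/-- The `G`-radical is stable under `G`. -/
theorem smul_mem_gRadical (h : G) {x : R} (hx : x ∈ gRadical R G) : h • x ∈ gRadical R G := by
  obtain ⟨n, a, b, hn, hab, rfl⟩ := hx
  refine ⟨n, fun i => h • a i, fun i => h • b i, hn, fun g hg => ?_, ?_⟩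
  · have hg' : h⁻¹ * g * h ≠ 1 := fun e => hg (by
      have : g = h * (h⁻¹ * g * h) * h⁻¹ := by group
      rw [this, e]; group)
    have := congrArg (h • ·) (hab _ hg')
    simpa [Finset.smul_sum, smul_mul', smul_smul, mul_assoc] using this
  · simp [Finset.smul_sum, smul_mul']

/-! ### The skew group algebra `B = R * G` -/

/-- The skew group algebra `R * G`: its elements are the sums `∑ r_g g`, and
`(r g) (s h) = r (g · s) gh`. -/
abbrev SkewGroupAlgebra := SkewMonoidAlgebra R G

/-- The ideal `𝔟 = 𝔯 ⊗ kG` of `R * G`: the elements all of whose coefficients lie in the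
`G`-radical `𝔯`. -/
def skewRadical : Ideal (SkewGroupAlgebra R G) where
  carrier := {x | ∀ g, x.coeff g ∈ gRadical R G}
  add_mem' hx hy g := by simpa using (gRadical R G).add_mem (hx g) (hy g)
  zero_mem' g := by simp
  smul_mem' c x hx g := by
    classical
    rw [smul_eq_mul, SkewMonoidAlgebra.coeff_mul, SkewMonoidAlgebra.sum_def, Finsupp.sum]
    refine Ideal.sum_mem _ fun a _ => ?_
    rw [SkewMonoidAlgebra.sum_def, Finsupp.sum]
    refine Ideal.sum_mem _ fun b _ => ?_
    split_ifs
    · exact Ideal.mul_mem_left _ _ (smul_mem_gRadical R G _ (hx b))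
    · exact Ideal.zero_mem _

instance : (skewRadical R G).IsTwoSided where
  mul_mem_of_left {x} c hx g := by
    classical
    rw [SkewMonoidAlgebra.coeff_mul, SkewMonoidAlgebra.sum_def, Finsupp.sum]
    refine Ideal.sum_mem _ fun a _ => ?_
    rw [SkewMonoidAlgebra.sum_def, Finsupp.sum]
    refine Ideal.sum_mem _ fun b _ => ?_
    split_ifs
    · exact Ideal.mul_mem_right _ _ (hx a)
    · exact Ideal.zero_mem _

/-- The ring homomorphism `R * G → End_ℤ(R)`, sending `r g` to `x ↦ r (g · x)`. -/
def skewToEnd : SkewGroupAlgebra R G →+* AddMonoid.End R :=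
  SkewMonoidAlgebra.liftNCRingHom (Module.toAddMonoidEnd R R) (DistribMulAction.toAddMonoidEnd G R)
    (by intro r g; ext x; exact (smul_mul' g r x).symm)

/-- `R` as a left `R * G`-module: `(r g) · x = r (g · x)`. -/
instance : Module (SkewGroupAlgebra R G) R := Module.compHom R (skewToEnd R G)

theorem skew_single_smul (g : G) (r x : R) :
    (SkewMonoidAlgebra.single g r : SkewGroupAlgebra R G) • x = r * g • x := by
  change skewToEnd R G (SkewMonoidAlgebra.single g r) x = _
  have : skewToEnd R G (SkewMonoidAlgebra.single g r) =
      Module.toAddMonoidEnd R R r * DistribMulAction.toAddMonoidEnd G R g :=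
    SkewMonoidAlgebra.liftNC_single _ _ _ _
  rw [this]
  rfl

/-- A ring `T` is left noetherian if it is a finitely generated left module over a left noetherian
ring `S` along a ring homomorphism `f`. -/
theorem isNoetherianRing_of_ringHom {S T : Type u} [Ring S] [Ring T] [IsNoetherianRing S]
    (f : S →+* T) (F : Set T) (hF : F.Finite)
    (h : ∀ K : AddSubgroup T, (∀ s, ∀ x ∈ F, f s * x ∈ K) → ∀ t, t ∈ K) :
    IsNoetherianRing T := by
  let _ : Module S T := Module.compHom T f
  have hs : ∀ (s : S) (t : T), s • t = f s * t := fun _ _ => rfl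
  have : IsScalarTower S T T := ⟨fun s b c => mul_assoc (f s) b c⟩
  have : Module.Finite S T := by
    refine ⟨Submodule.fg_def.2 ⟨F, hF, ?_⟩⟩
    rw [eq_top_iff]
    rintro t -
    refine h (Submodule.span S F).toAddSubgroup (fun s x hx => ?_) t
    rw [← hs]
    exact Submodule.smul_mem _ s (Submodule.subset_span hx)
  exact IsNoetherianRing.of_finite S T

/-- The skew group algebra of a right noetherian ring by a finite group is right noetherian. -/
instance [Finite G] [IsNoetherianRing Rᵐᵒᵖ] : IsNoetherianRing (SkewGroupAlgebra R G)ᵐᵒᵖ := by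
  refine isNoetherianRing_of_ringHom
    (RingHom.op (SkewMonoidAlgebra.singleOneRingHom : R →+* SkewGroupAlgebra R G))
    (Set.range fun g : G => op (SkewMonoidAlgebra.single g (1 : R))) (Set.finite_range _) ?_
  rintro K hK ⟨b⟩
  change op b ∈ K
  induction b using SkewMonoidAlgebra.induction_on with
  | zero => exact K.zero_mem
  | single g r =>
    have h := hK (op (g⁻¹ • r)) _ ⟨g, rfl⟩
    have e : (SkewMonoidAlgebra.single g 1 : SkewGroupAlgebra R G) *
        SkewMonoidAlgebra.single 1 (g⁻¹ • r) = SkewMonoidAlgebra.single g r := by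
      rw [SkewMonoidAlgebra.single_mul_single]
      simp
    rw [← e]
    exact h
  | add a b ha hb => exact K.add_mem ha hb

/-! ### The invariant subalgebra `A = R^G` -/

variable [SMulCommClass G k R]

/-- The invariant subalgebra `R^G`. -/
abbrev Invariants : Subalgebra k R := FixedPoints.subalgebra k R G

/-- The ideal `𝔞 = 𝔯 ∩ A` of `A = R^G`. -/
abbrev invRadical : Ideal (Invariants k R G) := (gRadical R G).comap (Invariants k R G).val

/-- `R` as a right module over `A = R^G`, by multiplication in `R`. -/
instance : Module (Invariants k R G)ᵐᵒᵖ R :=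
  Module.compHom R (RingHom.op ((Invariants k R G).val : Invariants k R G →+* R))

theorem inv_op_smul (a : Invariants k R G) (x : R) : op a • x = x * (a : R) := rfl

/-- `R` is an `R * G`-`R^G`-bimodule. -/
instance : SMulCommClass (SkewGroupAlgebra R G) (Invariants k R G)ᵐᵒᵖ R where
  smul_comm b a x := by
    induction b using SkewMonoidAlgebra.induction_on with
    | zero => simp
    | single g r =>
      have ha : g • (a.unop : R) = (a.unop : R) := a.unop.2 g
      change _ • (x * (a.unop : R)) = (_ • x) * (a.unop : R)
      rw [skew_single_smul, skew_single_smul, smul_mul', ha, mul_assoc]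
    | add b c hb hc => rw [add_smul, add_smul, hb, hc, smul_add]

/-- If `|G|` is invertible in `k`, then the invariants of a right noetherian algebra form a right
noetherian algebra. -/
instance [Finite G] [NeZero (Nat.card G : k)] [IsNoetherianRing Rᵐᵒᵖ] :
    IsNoetherianRing (Invariants k R G)ᵐᵒᵖ := by
  cases nonempty_fintype G
  let tr : R →+ Invariants k R G :=
    { toFun x := ⟨(Nat.card G : k)⁻¹ • ∑ g : G, g • x, fun h => by
        rw [smul_comm, Finset.smul_sum]
        simp only [smul_smul]
        rw [Fintype.sum_equiv (Equiv.mulLeft h) (fun g => (h * g) • x) (fun g => g • x)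
          fun g => rfl]⟩
      map_zero' := by ext; simp
      map_add' x y := by ext; simp [Finset.sum_add_distrib] }
  have htr : ∀ (a : Invariants k R G) (x : R), tr (a * x) = a * tr x := fun a x => by
    ext
    have ha : ∀ g : G, g • (a : R) = a := a.2
    simp [tr, smul_mul', ha, ← Finset.mul_sum]
  have htr1 : tr 1 = 1 := by
    ext
    have : (Nat.card G : k) ≠ 0 := NeZero.ne _
    simp only [tr, AddMonoidHom.coe_mk, ZeroHom.coe_mk, smul_one, Finset.sum_const,
      Finset.card_univ, ← Nat.card_eq_fintype_card]
    rw [← Nat.cast_smul_eq_nsmul k, smul_smul, inv_mul_cancel₀ this, one_smul]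
    rfl
  let φ : (Invariants k R G)ᵐᵒᵖ →+* Rᵐᵒᵖ :=
    RingHom.op ((Invariants k R G).val : Invariants k R G →+* R)
  have key : ∀ (I : Ideal (Invariants k R G)ᵐᵒᵖ) (x : Rᵐᵒᵖ), x ∈ I.map φ →
      ∀ c : R, op (tr (x.unop * c)) ∈ I := by
    intro I x hx
    induction hx using Submodule.span_induction with
    | mem x hx =>
      obtain ⟨i, hi, rfl⟩ := hx
      intro c
      have : op (tr ((φ i).unop * c)) = op (tr c) * i := unop_injective (htr i.unop c)
      rw [this]
      exact I.mul_mem_left _ hi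
    | zero => intro c; simp
    | add x y _ _ hx hy =>
      intro c
      rw [MulOpposite.unop_add, add_mul, map_add, MulOpposite.op_add]
      exact I.add_mem (hx c) (hy c)
    | smul d x _ hx =>
      intro c
      rw [smul_eq_mul, unop_mul, mul_assoc]
      exact hx _
  have hcomap : ∀ I : Ideal (Invariants k R G)ᵐᵒᵖ, (I.map φ).comap φ = I := fun I => by
    refine le_antisymm (fun x hx => ?_) Ideal.le_comap_map
    have h := key I _ hx 1
    have : tr ((φ x).unop * 1) = x.unop := by
      rw [show (φ x).unop = (x.unop : R) from rfl, htr, htr1, mul_one]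
    rwa [this] at h
  have hle : ∀ I J : Ideal (Invariants k R G)ᵐᵒᵖ, I.map φ ≤ J.map φ ↔ I ≤ J := fun I J =>
    ⟨fun h => by rw [← hcomap I, ← hcomap J]; exact Ideal.comap_mono h, Ideal.map_mono⟩
  exact isNoetherian_mk ⟨OrderEmbedding.wellFounded
    (OrderEmbedding.ofMapLEIff _ hle).dual (isNoetherian_iff'.1 inferInstance).wf⟩

/-- `𝔞` and `𝔯` are cofinal: `𝔞 R = R 𝔞`, and for each `s` there is `n` with `𝔯 ^ n ⊆ 𝔞 ^ s R`.
(The inclusions `𝔞 ^ n R ⊆ 𝔯 ^ n` always hold, so the two filtrations are then cofinal.) -/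
def Cofinal : Prop :=
  (Submodule.span Rᵐᵒᵖ (Subtype.val '' (invRadical k R G : Set (Invariants k R G))) : Set R) =
      (Submodule.span R (Subtype.val '' (invRadical k R G : Set (Invariants k R G))) : Set R) ∧
    ∀ s : ℕ, ∃ n : ℕ, ∀ x ∈ gRadical R G ^ n,
      x ∈ Submodule.span Rᵐᵒᵖ (Subtype.val '' ((invRadical k R G ^ s : Ideal _) : Set (Invariants k R G)))

/-- The functor `Hom_A(R, -) : Mod A ⥤ Mod B`. -/
abbrev homR : ModuleCat.{u} (Invariants k R G)ᵐᵒᵖ ⥤ ModuleCat.{u} (SkewGroupAlgebra R G)ᵐᵒᵖ :=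
  homFunctor (SkewGroupAlgebra R G) (Invariants k R G) R

/-- The functor `- ⊗_B R : Mod B ⥤ Mod A`. -/
abbrev tensorR : ModuleCat.{u} (SkewGroupAlgebra R G)ᵐᵒᵖ ⥤ ModuleCat.{u} (Invariants k R G)ᵐᵒᵖ :=
  tensorFunctor (SkewGroupAlgebra R G) (Invariants k R G) R

end GroupAction

end RightTorsion

end

noncomputable section

namespace RightTorsion

/-! ### Torsion conditions in terms of elements -/

section Torsion

variable (S : Type u) [Ring S] (I : Ideal S)

/-! Put e = |G|⁻¹ ∑ g in B. Since ge = e for g in G, the map p ↦ pe identifies R with the bimodule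
Be, and x ↦ e · x is a right A-linear retraction ρ of R onto A (`reynolds`). Hence M ⊗_B R is M ↦ Me
in disguise, and every element ced of BeB acts on R through A: (ced) · x = (c · 1) ρ(d · x)
(`mul_avg_smul`).

Two consequences concern the adjunction. The counit Hom_A(R, N) ⊗_B R → N is an isomorphism, because
e turns φ into r ↦ φ(1) ρ(r) (`isIso_counit`). The unit M → Hom_A(R, M ⊗_B R) has kernel and
cokernel killed by BeB. Pertinence gives 𝔟 ⊆ BeB: in ∑ aᵢ (∑ h) bᵢ only the term h = 1 survives, and
it equals ∑ aᵢ bᵢ (`skewRadical_avg_induction`). So the unit has torsion kernel and cokernel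
(`isoModTorsion_unit`).

It remains that both functors respect torsion. For M ↦ Me this follows from 𝔞 ^ n ⊆ 𝔟 ^ n. For
Hom_A(R, -), finite generation of R over A yields one exponent n valid on all of R, and cofinality
gives 𝔟 ^ m R ⊆ 𝔯 ^ m ⊆ 𝔞 ^ n R ⊆ R 𝔞 ^ n for some m (`exists_skewRadical_pow_smul_mem`). This
settles kernels; for cokernels one more factor from 𝔟 ⊆ BeB produces the lifts, through the free
module A. -/

theorem isoModTorsion_iff [IsNoetherianRing Sᵐᵒᵖ] [I.IsTwoSided] {M N : ModuleCat.{u} Sᵐᵒᵖ}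
    (f : M ⟶ N) : isoModTorsion S I f ↔
      (∀ x : M, f x = 0 → ∃ n : ℕ, ∀ s ∈ I ^ n, op s • x = 0) ∧
        ∀ y : N, ∃ n : ℕ, ∀ s ∈ I ^ n, ∃ x : M, f x = op s • y := by
  have h : isoModTorsion S I f ↔ torsion S I (.of _ (LinearMap.ker f.hom)) ∧
      torsion S I (.of _ (N ⧸ LinearMap.range f.hom)) :=
    and_congr ((torsion S I).prop_iff_of_iso (ModuleCat.kernelIsoKer f))
      ((torsion S I).prop_iff_of_iso (ModuleCat.cokernelIsoRangeQuotient f))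
  rw [h]
  refine and_congr ⟨fun h x hx => ?_, fun h x => ?_⟩ ⟨fun h y => ?_, fun h y => ?_⟩
  · obtain ⟨n, hn⟩ := h ⟨x, hx⟩
    exact ⟨n, fun s hs => congrArg Subtype.val (hn s hs)⟩
  · obtain ⟨n, hn⟩ := h x.1 x.2
    exact ⟨n, fun s hs => Subtype.ext (hn s hs)⟩
  · obtain ⟨n, hn⟩ := h (Submodule.Quotient.mk y)
    exact ⟨n, fun s hs => (Submodule.Quotient.mk_eq_zero _).1 (hn s hs)⟩
  · obtain ⟨y, rfl⟩ := Submodule.mkQ_surjective _ y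
    obtain ⟨n, hn⟩ := h y
    exact ⟨n, fun s hs => (Submodule.Quotient.mk_eq_zero _).2 (hn s hs)⟩

variable {S I} in
/-- On a finitely generated module the exponents in a torsion condition can be chosen uniformly. -/
theorem exists_pow_forall_smul_mem [I.IsTwoSided] {P : Type*} [AddCommGroup P] [Module Sᵐᵒᵖ P]
    [Module.Finite Sᵐᵒᵖ P] (D : Submodule Sᵐᵒᵖ P)
    (h : ∀ p : P, ∃ n : ℕ, ∀ s ∈ I ^ n, op s • p ∈ D) :
    ∃ n : ℕ, ∀ p : P, ∀ s ∈ I ^ n, op s • p ∈ D := by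
  obtain ⟨F, hF⟩ := Module.Finite.fg_top (R := Sᵐᵒᵖ) (M := P)
  choose n hn using h
  refine ⟨F.sup n, fun p => ?_⟩
  have hp : p ∈ Submodule.span Sᵐᵒᵖ (F : Set P) := hF ▸ Submodule.mem_top
  induction hp using Submodule.span_induction with
  | mem p hp => exact fun s hs => hn p s (Ideal.pow_le_pow_right (Finset.le_sup hp) hs)
  | zero => intro s _; simp
  | add p q _ _ hp hq => intro s hs; rw [smul_add]; exact D.add_mem (hp s hs) (hq s hs)
  | smul c p _ hp =>
    intro s hs
    rw [smul_smul]
    exact hp (c.unop * s) ((I ^ _).mul_mem_left _ hs)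

end Torsion

/-! ### Tensor-Hom adjunction for a bimodule -/

section Bimodule

variable {S T : Type u} [Ring S] [Ring T] {P : Type u} [AddCommGroup P]
  [Module S P] [Module Tᵐᵒᵖ P] [SMulCommClass S Tᵐᵒᵖ P]
  {M : Type u} [AddCommGroup M] [Module Sᵐᵒᵖ M]

/-- The pure tensor `m ⊗ p` in `M ⊗_S P`. -/
def BimodTensor.mk (m : M) (p : P) : BimodTensor S T P M := Submodule.Quotient.mk (p ⊗ₜ m)

theorem BimodTensor.mk_add_left (m m' : M) (p : P) :
    mk (S := S) (T := T) (m + m') p = mk m p + mk m' p := by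
  simp only [mk, TensorProduct.tmul_add, Submodule.Quotient.mk_add]

theorem BimodTensor.mk_add_right (m : M) (p p' : P) :
    mk (S := S) (T := T) m (p + p') = mk m p + mk m p' := by
  simp only [mk, TensorProduct.add_tmul, Submodule.Quotient.mk_add]

theorem BimodTensor.mk_zero_left (p : P) : mk (S := S) (T := T) (0 : M) p = 0 := by
  simp only [mk, TensorProduct.tmul_zero, Submodule.Quotient.mk_zero]

theorem BimodTensor.mk_op_smul (m : M) (s : S) (p : P) :
    mk (S := S) (T := T) (op s • m) p = mk m (s • p) :=
  (Submodule.Quotient.eq _).2 (Submodule.subset_span ⟨m, s, p, rfl⟩)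

theorem BimodTensor.smul_mk (t : Tᵐᵒᵖ) (m : M) (p : P) :
    t • mk (S := S) (T := T) m p = mk (S := S) (T := T) m (t • p) := rfl

@[elab_as_elim]
theorem BimodTensor.induction_on {C : BimodTensor S T P M → Prop} (z : BimodTensor S T P M)
    (mk : ∀ m p, C (mk m p)) (add : ∀ y z, C y → C z → C (y + z)) : C z := by
  obtain ⟨z, rfl⟩ := Submodule.mkQ_surjective _ z
  induction z using TensorProduct.induction_on with
  | zero => simpa [BimodTensor.mk] using mk 0 0
  | tmul p m => exact mk m p
  | add x y hx hy => rw [map_add]; exact add _ _ hx hy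

/-- The map of right `T`-modules on `M ⊗_S P` induced by a balanced biadditive map. -/
def BimodTensor.lift {N : Type*} [AddCommGroup N] [Module Tᵐᵒᵖ N] (φ : M → P →ₗ[Tᵐᵒᵖ] N)
    (hadd : ∀ m m' p, φ (m + m') p = φ m p + φ m' p)
    (hbal : ∀ m (s : S) p, φ (op s • m) p = φ m (s • p)) :
    BimodTensor S T P M →ₗ[Tᵐᵒᵖ] N :=
  let ψ : P →+ M →+ N := AddMonoidHom.mk' (fun p => AddMonoidHom.mk' (fun m => φ m p)
    fun m m' => hadd m m' p) fun p q => by ext m; exact (φ m).map_add p q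
  let Ψ : (P ⊗[ℤ] M) →+ N := TensorProduct.liftAddHom ψ fun z p m => by
    rw [map_zsmul, map_zsmul]; rfl
  let Ψ' : (P ⊗[ℤ] M) →ₗ[Tᵐᵒᵖ] N :=
    { Ψ with
      map_smul' := fun t z => by
        change Ψ (t • z) = t • Ψ z
        induction z using TensorProduct.induction_on with
        | zero => simp
        | tmul p m => exact (φ m).map_smul t p
        | add x y hx hy => rw [smul_add, map_add, map_add, smul_add, hx, hy] }
  Submodule.liftQ _ Ψ' <| by
    rw [tensorRel, Submodule.span_le]
    rintro _ ⟨m, s, p, rfl⟩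
    change Ψ' _ = 0
    rw [map_sub, sub_eq_zero]
    exact hbal m s p

variable (S T P)

/-- The unit `M → Hom_T(P, M ⊗_S P)`. -/
def tensorHomUnit : 𝟭 (ModuleCat.{u} Sᵐᵒᵖ) ⟶ tensorFunctor S T P ⋙ homFunctor S T P where
  app M := ModuleCat.ofHom
    { toFun m := ({ toFun := fun p => BimodTensor.mk m p
                    map_add' := BimodTensor.mk_add_right m
                    map_smul' := fun _ _ => rfl } : P →ₗ[Tᵐᵒᵖ] BimodTensor S T P M)
      map_add' m m' := BimodHom.ext fun p => BimodTensor.mk_add_left m m' p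
      map_smul' s m := BimodHom.ext fun p => BimodTensor.mk_op_smul m s.unop p }
  naturality _ _ _ := rfl

/-- The counit `Hom_T(P, N) ⊗_S P → N`. -/
def homTensorCounit : homFunctor S T P ⋙ tensorFunctor S T P ⟶ 𝟭 (ModuleCat.{u} Tᵐᵒᵖ) where
  app N := ModuleCat.ofHom
    (BimodTensor.lift (M := BimodHom S T P N) (fun φ => φ.toLin) (fun _ _ _ => rfl)
      fun _ _ _ => rfl)
  naturality N N' f := ModuleCat.hom_ext <| LinearMap.ext fun z => by
    induction z using BimodTensor.induction_on with
    | mk m p => rfl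
    | add y z hy hz =>
      exact (LinearMap.map_add _ y z).trans
        ((congrArg₂ _ hy hz).trans (LinearMap.map_add _ y z).symm)

end Bimodule

/-! ### Functors induced on localizations -/

section Localization

variable {C D : Type*} [Category* C] [Category* D] {W : MorphismProperty C}
  {V : MorphismProperty D} {F : C ⥤ D} {T : D ⥤ C}
  (hF : W.IsInvertedBy (F ⋙ V.Q)) (hT : V.IsInvertedBy (T ⋙ W.Q))

include hF hT in
-- By the universal property of the localization, natural isomorphisms can be tested after `W.Q`.
-- Thus a unit or counit needs to be invertible only in the quotient category.
theorem nonempty_lift_comp_lift_iso (e : (F ⋙ T) ⋙ W.Q ≅ W.Q) :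
    Nonempty (Localization.Construction.lift _ hF ⋙ Localization.Construction.lift _ hT ≅
      𝟭 W.Localization) := by
  have h : W.Q ⋙ Localization.Construction.lift _ hF ⋙ Localization.Construction.lift _ hT =
      (F ⋙ T) ⋙ W.Q := by
    rw [← Functor.assoc, Localization.Construction.fac, Functor.assoc,
      Localization.Construction.fac, Functor.assoc]
  have : Localization.Lifting W.Q W ((F ⋙ T) ⋙ W.Q)
    (Localization.Construction.lift _ hF ⋙ Localization.Construction.lift _ hT) := ⟨eqToIso h⟩
  exact ⟨Localization.liftNatIso W.Q W ((F ⋙ T) ⋙ W.Q) W.Q _ _ e⟩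

end Localization

/-! ### Powers of 𝔯, 𝔟 and 𝔞, and cofinality -/

section GroupAction

variable (k R G : Type u) [Field k] [Ring R] [Algebra k R] [Group G] [MulSemiringAction G R]

theorem smul_mem_gRadical_pow (n : ℕ) (h : G) {x : R} (hx : x ∈ gRadical R G ^ n) :
    h • x ∈ gRadical R G ^ n := by
  induction n generalizing x with
  | zero => rw [Submodule.pow_zero, Ideal.one_eq_top]; trivial
  | succ n ih =>
    rw [Ideal.IsTwoSided.pow_succ] at hx ⊢
    induction hx using Submodule.mul_induction_on' with
    | mem_mul_mem a ha b hb =>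
      rw [smul_mul']
      exact Ideal.mul_mem_mul (smul_mem_gRadical R G h ha) (ih hb)
    | add a _ b _ ha hb => rw [smul_add]; exact Ideal.add_mem _ ha hb

theorem skewRadical_induction {C : SkewGroupAlgebra R G → Prop} {b : SkewGroupAlgebra R G}
    (hb : b ∈ skewRadical R G) (single : ∀ g, ∀ r ∈ gRadical R G, C (.single g r))
    (add : ∀ b c, C b → C c → C (b + c)) : C b := by
  classical
  rw [← SkewMonoidAlgebra.sum_single b, SkewMonoidAlgebra.sum_def, Finsupp.sum]
  refine Finset.sum_induction _ C add ?_ fun g _ => single g _ (hb g)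
  -- The empty sum: zero is itself a monomial with coefficient in 𝔯.
  simpa using single 1 0 (Ideal.zero_mem _)

/-- 𝔟 ^ n R ⊆ 𝔯 ^ n: the group elements inside a product from 𝔟 ^ n do no harm, since the powers of
𝔯 are G-stable. -/
theorem skewRadical_pow_smul_mem (n : ℕ) {b : SkewGroupAlgebra R G} (hb : b ∈ skewRadical R G ^ n)
    (x : R) : b • x ∈ gRadical R G ^ n := by
  induction n generalizing b x with
  | zero => rw [Submodule.pow_zero, Ideal.one_eq_top]; trivial
  | succ n ih =>
    rw [Ideal.IsTwoSided.pow_succ] at hb ⊢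
    induction hb using Submodule.mul_induction_on' with
    | mem_mul_mem a ha b hb =>
      have hx := ih hb x
      rw [mul_smul]
      refine skewRadical_induction R G (C := fun a => a • b • x ∈ gRadical R G * gRadical R G ^ n)
        ha (fun g r hr => ?_) fun c d hc hd => ?_
      · rw [skew_single_smul]
        exact Ideal.mul_mem_mul hr (smul_mem_gRadical_pow R G n g hx)
      · rw [add_smul]
        exact Ideal.add_mem _ hc hd
    | add a _ b _ ha hb => rw [add_smul]; exact Ideal.add_mem _ ha hb

variable [SMulCommClass G k R]

/-- The inclusion of `R^G` into `R * G`. -/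
def invToSkew : Invariants k R G →+* SkewGroupAlgebra R G :=
  (SkewMonoidAlgebra.singleOneRingHom : R →+* SkewGroupAlgebra R G).comp
    ((Invariants k R G).val : Invariants k R G →+* R)

theorem invToSkew_smul (a : Invariants k R G) (x : R) : invToSkew k R G a • x = a * x := by
  change (SkewMonoidAlgebra.single 1 (a : R) : SkewGroupAlgebra R G) • x = _
  rw [skew_single_smul, one_smul]

theorem invToSkew_mem_pow (n : ℕ) {a : Invariants k R G} (ha : a ∈ invRadical k R G ^ n) :
    invToSkew k R G a ∈ skewRadical R G ^ n := by
  induction n generalizing a with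
  | zero => rw [Submodule.pow_zero, Ideal.one_eq_top]; trivial
  | succ n ih =>
    rw [Ideal.IsTwoSided.pow_succ] at ha ⊢
    induction ha using Submodule.mul_induction_on' with
    | mem_mul_mem a ha b hb =>
      rw [map_mul]
      refine Ideal.mul_mem_mul (fun g => ?_) (ih hb)
      change (SkewMonoidAlgebra.single 1 (a : R) : SkewGroupAlgebra R G).coeff g ∈ _
      classical
      rw [SkewMonoidAlgebra.coeff_single_apply]
      split_ifs
      · exact ha
      · exact Ideal.zero_mem _
    | add a _ b _ ha hb => rw [map_add]; exact Ideal.add_mem _ ha hb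

/-- The left ideal `R 𝔞 ^ n` of `R`. -/
def extPow (n : ℕ) : Ideal R :=
  Submodule.span R (Subtype.val '' ((invRadical k R G ^ n : Ideal _) : Set (Invariants k R G)))

variable {k R G} in
theorem extPow_mul_mem_succ {n : ℕ} {v : R} (hv : v ∈ extPow k R G n) {c : Invariants k R G}
    (hc : c ∈ invRadical k R G) : v * c ∈ extPow k R G (n + 1) := by
  induction hv using Submodule.span_induction with
  | mem x hx =>
    obtain ⟨a, ha, rfl⟩ := hx
    refine Submodule.subset_span ⟨a * c, ?_, rfl⟩
    rw [SetLike.mem_coe, Ideal.IsTwoSided.pow_add, Submodule.pow_one]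
    exact Ideal.mul_mem_mul ha hc
  | zero => simp
  | add x y _ _ hx hy => rw [add_mul]; exact Ideal.add_mem _ hx hy
  | smul t x _ hx => rw [smul_eq_mul, mul_assoc]; exact Ideal.mul_mem_left _ _ hx

variable {k R G} in
/-- If `𝔞 R = R 𝔞`, then the left ideals `R 𝔞 ^ n` are two-sided. -/
theorem extPow_mul_mem (hcof : Cofinal k R G) {n : ℕ} {v : R} (hv : v ∈ extPow k R G n) (r : R) :
    v * r ∈ extPow k R G n := by
  induction n generalizing v r with
  | zero =>
    have : (1 : R) ∈ extPow k R G 0 := Submodule.subset_span ⟨1, by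
      rw [Submodule.pow_zero, Ideal.one_eq_top]; trivial, rfl⟩
    rw [(Ideal.eq_top_iff_one _).2 this]
    trivial
  | succ n ih =>
    -- (R 𝔞 ^ n)(R 𝔞) ⊆ R 𝔞 ^ (n + 1): by the induction hypothesis, the middle factor from R is
    -- absorbed into R 𝔞 ^ n.
    have h₁ : ∀ y ∈ Submodule.span R (Subtype.val '' (invRadical k R G : Set (Invariants k R G))),
        ∀ v ∈ extPow k R G n, v * y ∈ extPow k R G (n + 1) := by
      intro y hy
      induction hy using Submodule.span_induction with
      | mem y hy =>
        obtain ⟨c, hc, rfl⟩ := hy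
        exact fun v hv => extPow_mul_mem_succ hv hc
      | zero => intro v _; simp
      | add x y _ _ hx hy =>
        intro v hv; rw [mul_add]; exact Ideal.add_mem _ (hx v hv) (hy v hv)
      | smul t x _ hx =>
        intro v hv
        rw [smul_eq_mul, ← mul_assoc]
        exact hx _ (ih hv t)
    induction hv using Submodule.span_induction with
    | mem x hx =>
      obtain ⟨a, ha, rfl⟩ := hx
      rw [SetLike.mem_coe, Ideal.IsTwoSided.pow_add, Submodule.pow_one] at ha
      induction ha using Submodule.mul_induction_on' with
      | mem_mul_mem b hb c hc =>
        -- The equality 𝔞 R = R 𝔞 moves r to the left of 𝔞.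
        have hcr : (c : R) * r ∈
            (Submodule.span R (Subtype.val '' (invRadical k R G : Set (Invariants k R G)))) := by
          rw [← SetLike.mem_coe, ← hcof.1]
          exact Submodule.smul_mem _ (op r) (Submodule.subset_span ⟨c, hc, rfl⟩)
        rw [show ((b * c : Invariants k R G) : R) * r = b * (c * r) from mul_assoc _ _ _]
        exact h₁ _ hcr _ (Submodule.subset_span ⟨b, hb, rfl⟩)
      | add a _ b _ ha hb =>
        rw [show ((a + b : Invariants k R G) : R) * r = a * r + b * r from add_mul _ _ _]
        exact Ideal.add_mem _ ha hb
    | zero => simp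
    | add x y _ _ hx hy => rw [add_mul]; exact Ideal.add_mem _ hx hy
    | smul t x _ hx => rw [smul_eq_mul, mul_assoc]; exact Ideal.mul_mem_left _ _ hx

variable {k R G} in
/-- A right `A`-submodule of `R` that contains `R 𝔞 ^ n` contains `𝔟 ^ m R` for some `m`. -/
theorem exists_skewRadical_pow_smul_mem (hcof : Cofinal k R G) (n : ℕ) :
    ∃ m : ℕ, ∀ D : AddSubgroup R,
      (∀ r : R, ∀ a ∈ invRadical k R G ^ n, op a • r ∈ D) →
        ∀ b ∈ skewRadical R G ^ m, ∀ x : R, b • x ∈ D := by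
  obtain ⟨m, hm⟩ := hcof.2 n
  refine ⟨m, fun D hD b hb x => ?_⟩
  have h₁ := hm _ (skewRadical_pow_smul_mem R G m hb x)
  -- Cofinality speaks of 𝔞 ^ n R, but D is known only to contain R 𝔞 ^ n; two-sidedness of the
  -- latter bridges the gap.
  have h₂ : b • x ∈ extPow k R G n := by
    generalize b • x = y at h₁ ⊢
    induction h₁ using Submodule.span_induction with
    | mem x hx => exact Submodule.subset_span hx
    | zero => exact Ideal.zero_mem _
    | add x y _ _ hx hy => exact Ideal.add_mem _ hx hy
    | smul t x _ hx => exact extPow_mul_mem hcof hx t.unop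
  -- D is only an additive subgroup, so the left factor has to be carried through the induction.
  suffices ∀ y ∈ extPow k R G n, ∀ t : R, t * y ∈ D by simpa using this _ h₂ 1
  intro y hy
  induction hy using Submodule.span_induction with
  | mem y hy =>
    obtain ⟨a, ha, rfl⟩ := hy
    exact fun t => hD t a ha
  | zero => simp
  | add y z _ _ hy hz => intro t; rw [mul_add]; exact D.add_mem (hy t) (hz t)
  | smul s y _ hy => intro t; rw [smul_eq_mul, ← mul_assoc]; exact hy _

/-! ### The averaging idempotent -/

variable [Fintype G]

/-- The idempotent `e = |G|⁻¹ ∑ g` of `R * G`. -/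
def avg : SkewGroupAlgebra R G :=
  ∑ g : G, SkewMonoidAlgebra.single g (algebraMap k R (Nat.card G : k)⁻¹)

/-- Since ge = e, one has g p e = (g · p) g e = (g · p) e. Thus p ↦ pe is B-linear from R to Be. -/
theorem mul_single_mul_avg (s : SkewGroupAlgebra R G) (p : R) :
    s * (SkewMonoidAlgebra.single 1 p * avg k R G) =
      SkewMonoidAlgebra.single 1 (s • p) * avg k R G := by
  induction s using SkewMonoidAlgebra.induction_on with
  | zero => simp
  | single g r =>
    rw [skew_single_smul]
    simp only [avg, Finset.mul_sum, SkewMonoidAlgebra.single_mul_single, smul_mul', one_mul,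
      smul_algebraMap, mul_assoc]
    exact Fintype.sum_equiv (Equiv.mulLeft g) _ _ fun h => rfl
  | add b c hb hc => rw [add_mul, hb, hc, add_smul, SkewMonoidAlgebra.single_add, add_mul]

theorem mul_avg (s : SkewGroupAlgebra R G) :
    s * avg k R G = SkewMonoidAlgebra.single 1 (s • (1 : R)) * avg k R G := by
  rw [← mul_single_mul_avg, SkewMonoidAlgebra.single_one_one, one_mul]

theorem avg_smul (x : R) :
    avg k R G • x = algebraMap k R (Nat.card G : k)⁻¹ * ∑ g : G, g • x := by
  simp only [avg, Finset.sum_smul, skew_single_smul, Finset.mul_sum]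

/-- The projection `x ↦ e x` of `R` onto `R^G`, as a map of right `R^G`-modules. -/
def reynolds : R →ₗ[(Invariants k R G)ᵐᵒᵖ] Invariants k R G where
  toFun x := ⟨avg k R G • x, fun h => by
    rw [avg_smul, smul_mul', smul_algebraMap, Finset.smul_sum]
    congr 1
    simp only [smul_smul]
    exact Fintype.sum_equiv (Equiv.mulLeft h) _ _ fun g => rfl⟩
  map_add' x y := Subtype.ext (smul_add _ _ _)
  map_smul' a x := Subtype.ext (smul_comm _ _ _)

theorem coe_reynolds (x : R) : (reynolds k R G x : R) = avg k R G • x := rfl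

variable [NeZero (Nat.card G : k)]

theorem avg_smul_one : avg k R G • (1 : R) = 1 := by
  have h : (Nat.card G : k) ≠ 0 := NeZero.ne _
  rw [avg_smul]
  simp only [smul_one, Finset.sum_const, Finset.card_univ, ← Nat.card_eq_fintype_card,
    nsmul_eq_mul, mul_one]
  rw [← map_natCast (algebraMap k R), ← map_mul, inv_mul_cancel₀ h, map_one]

theorem reynolds_one : reynolds k R G 1 = 1 := Subtype.ext (avg_smul_one k R G)

/-- `𝔟` is contained in the ideal of `R * G` generated by `e`. -/
theorem skewRadical_avg_induction {C : SkewGroupAlgebra R G → Prop} {b : SkewGroupAlgebra R G}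
    (hb : b ∈ skewRadical R G) (mul : ∀ c d, C (c * avg k R G * d))
    (add : ∀ b c, C b → C c → C (b + c)) : C b := by
  classical
  have h : (Nat.card G : k) ≠ 0 := NeZero.ne _
  refine skewRadical_induction R G hb ?_ add
  rintro g r ⟨n, a, b, -, hab, rfl⟩
  -- The factor |G| cancels the denominator of e. Expanding e gives ∑_h (∑ aᵢ (h · bᵢ)) hg, where
  -- pertinence kills every h ≠ 1.
  have key : (SkewMonoidAlgebra.single g (∑ i, a i * b i) : SkewGroupAlgebra R G) =
      ∑ i, SkewMonoidAlgebra.single 1 (a i * algebraMap k R (Nat.card G : k)) * avg k R G *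
        SkewMonoidAlgebra.single g (b i) := by
    have h₁ : ∀ i, SkewMonoidAlgebra.single 1 (a i * algebraMap k R (Nat.card G : k)) *
        avg k R G * SkewMonoidAlgebra.single g (b i) =
        ∑ h : G, SkewMonoidAlgebra.single (h * g) (a i * h • b i) := fun i => by
      simp only [avg, Finset.mul_sum, Finset.sum_mul, SkewMonoidAlgebra.single_mul_single,
        one_mul, one_smul, mul_assoc]
      refine Finset.sum_congr rfl fun g _ => ?_
      rw [← mul_assoc (algebraMap k R _) (algebraMap k R _), ← map_mul, mul_inv_cancel₀ h, map_one,
        one_mul]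
    symm
    rw [Finset.sum_congr rfl fun i _ => h₁ i, Finset.sum_comm]
    have h₂ : ∀ h : G, ∑ i, (SkewMonoidAlgebra.single (h * g) (a i * h • b i) :
        SkewGroupAlgebra R G) = SkewMonoidAlgebra.single (h * g) (∑ i, a i * h • b i) := fun h =>
      (map_sum (AddMonoidHom.mk' (fun r : R => SkewMonoidAlgebra.single (h * g) r)
        fun r s => SkewMonoidAlgebra.single_add (h * g) r s) _ _).symm
    rw [Finset.sum_congr rfl fun h _ => h₂ h, Finset.sum_eq_single (1 : G)]
    · simp
    · intro h _ hh
      rw [hab h hh, SkewMonoidAlgebra.single_zero_right]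
    · simp
  rw [key]
  exact Finset.sum_induction _ C add (by simpa using mul 0 0) fun i _ => mul _ _

theorem single_mul_avg_smul (r x : R) :
    ((SkewMonoidAlgebra.single 1 r : SkewGroupAlgebra R G) * avg k R G) • x =
      r * (reynolds k R G x : R) := by
  rw [mul_smul, skew_single_smul, one_smul, coe_reynolds]

/-- As ce = (c · 1)e, the action of ce on R factors through A. Everything about BeB below rests on
this. -/
theorem mul_avg_smul (c : SkewGroupAlgebra R G) (x : R) :
    (c * avg k R G) • x = (c • (1 : R)) * (reynolds k R G x : R) := by
  rw [mul_avg, single_mul_avg_smul]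

theorem single_mul_avg_smul_one (r : R) :
    ((SkewMonoidAlgebra.single 1 r : SkewGroupAlgebra R G) * avg k R G) • (1 : R) = r := by
  rw [mul_smul, avg_smul_one, skew_single_smul, one_smul, mul_one]

omit [NeZero (Nat.card G : k)] in
-- Invariants commute with e, so p ↦ pe is also right A-linear.
theorem single_mul_avg_mul_inv (p : R) (a : Invariants k R G) :
    (SkewMonoidAlgebra.single 1 (p * a) : SkewGroupAlgebra R G) * avg k R G =
      SkewMonoidAlgebra.single 1 p * avg k R G * invToSkew k R G a := by
  have ha : ∀ g : G, g • (a : R) = a := a.2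
  change _ = SkewMonoidAlgebra.single 1 p * avg k R G * SkewMonoidAlgebra.single 1 (a : R)
  simp only [avg, Finset.mul_sum, Finset.sum_mul, SkewMonoidAlgebra.single_mul_single, ha,
    one_mul, mul_one, one_smul, mul_assoc, Algebra.commutes]

/-- `R` is a finitely generated right `R^G`-module. -/
theorem finite_invariants_op [IsNoetherianRing Rᵐᵒᵖ] :
    Module.Finite (Invariants k R G)ᵐᵒᵖ R := by
  -- The right ideal generated by all re is generated by finitely many rᵢe. Writing re = ∑ rᵢ e dᵢ
  -- and acting on 1 gives r = ∑ rᵢ ρ(dᵢ · 1), so the rᵢ generate R over A.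
  let φ : R → (SkewGroupAlgebra R G)ᵐᵒᵖ := fun r => op (SkewMonoidAlgebra.single 1 r * avg k R G)
  obtain ⟨F, hF, hspan⟩ := (Submodule.fg_span_iff_fg_span_finset_subset (Set.range φ)).1
    (IsNoetherian.noetherian (Submodule.span (SkewGroupAlgebra R G)ᵐᵒᵖ (Set.range φ)))
  rw [← Set.image_univ] at hF
  classical
  obtain ⟨E, -, rfl⟩ := Finset.subset_set_image_iff.1 hF
  refine ⟨⟨E, eq_top_iff.2 fun x _ => ?_⟩⟩
  have hx : φ x ∈
      Submodule.span (SkewGroupAlgebra R G)ᵐᵒᵖ (E.image φ : Set (SkewGroupAlgebra R G)ᵐᵒᵖ) :=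
    hspan ▸ Submodule.subset_span ⟨x, rfl⟩
  -- All arguments t are needed, not only 1: right multiplication by c replaces t by c · t.
  suffices ∀ y : (SkewGroupAlgebra R G)ᵐᵒᵖ,
      y ∈ Submodule.span (SkewGroupAlgebra R G)ᵐᵒᵖ (E.image φ : Set (SkewGroupAlgebra R G)ᵐᵒᵖ) →
        ∀ t : R, y.unop • t ∈ Submodule.span (Invariants k R G)ᵐᵒᵖ (E : Set R) by
    simpa only [φ, unop_op, single_mul_avg_smul_one] using this _ hx 1
  intro y hy
  induction hy using Submodule.span_induction with
  | mem y hy =>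
    obtain ⟨r, hr, rfl⟩ := Finset.mem_image.1 hy
    intro t
    change ((SkewMonoidAlgebra.single 1 r : SkewGroupAlgebra R G) * avg k R G) • t ∈ _
    rw [single_mul_avg_smul]
    exact Submodule.smul_mem _ (op (reynolds k R G t)) (Submodule.subset_span hr)
  | zero => intro t; simp
  | add y z _ _ hy hz =>
    intro t
    rw [MulOpposite.unop_add, add_smul]
    exact Submodule.add_mem _ (hy t) (hz t)
  | smul c y _ hy =>
    intro t
    rw [smul_eq_mul, unop_mul, mul_smul]
    exact hy _

/-! ### The two functors modulo torsion, the unit and the counit -/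

section Functors

variable {M : Type u} [AddCommGroup M] [Module (SkewGroupAlgebra R G)ᵐᵒᵖ M]

/-- Every element of `M ⊗_B R` has the form `m e ⊗ 1`. -/
theorem exists_eq_mk_avg_smul (z : BimodTensor (SkewGroupAlgebra R G) (Invariants k R G) R M) :
    ∃ m : M, z = BimodTensor.mk (op (avg k R G) • m) 1 := by
  induction z using BimodTensor.induction_on with
  | mk m r =>
    -- Here r = (re) · 1, so m ⊗ r = (mr)e ⊗ 1.
    refine ⟨op (SkewMonoidAlgebra.single 1 r : SkewGroupAlgebra R G) • m, ?_⟩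
    rw [smul_smul, ← op_mul, BimodTensor.mk_op_smul, single_mul_avg_smul_one]
  | add y z hy hz =>
    obtain ⟨m, rfl⟩ := hy
    obtain ⟨m', rfl⟩ := hz
    exact ⟨m + m', by rw [smul_add, BimodTensor.mk_add_left]⟩

omit [NeZero (Nat.card G : k)] in
/-- If `m ⊗ p = 0` in `M ⊗_B R`, then `m (p e) = 0`. -/
theorem smul_eq_zero_of_mk_eq_zero {m : M} {p : R}
    (h : BimodTensor.mk (S := SkewGroupAlgebra R G) (T := Invariants k R G) m p = 0) :
    op (SkewMonoidAlgebra.single 1 p * avg k R G) • m = 0 := by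
  let _ : Module (Invariants k R G)ᵐᵒᵖ M := Module.compHom M (RingHom.op (invToSkew k R G))
  -- The map m ⊗ p ↦ m(pe) is well defined because p ↦ pe is a bimodule map.
  let φ (m : M) : R →ₗ[(Invariants k R G)ᵐᵒᵖ] M :=
    { toFun p := op (SkewMonoidAlgebra.single 1 p * avg k R G) • m
      map_add' p q := by
        rw [SkewMonoidAlgebra.single_add, add_mul, MulOpposite.op_add, add_smul]
      map_smul' a p := by
        change op (SkewMonoidAlgebra.single 1 (p * (a.unop : R)) * avg k R G) • m =
          op (invToSkew k R G a.unop) • op (SkewMonoidAlgebra.single 1 p * avg k R G) • m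
        rw [single_mul_avg_mul_inv, smul_smul, ← op_mul] }
  have hbal : ∀ (m : M) (s : SkewGroupAlgebra R G) (p : R), φ (op s • m) p = φ m (s • p) := by
    intro m s p
    change op (SkewMonoidAlgebra.single 1 p * avg k R G) • op s • m =
      op (SkewMonoidAlgebra.single 1 (s • p) * avg k R G) • m
    rw [smul_smul, ← op_mul, mul_single_mul_avg]
  have := congrArg (BimodTensor.lift φ (fun m m' p => smul_add _ m m') hbal) h
  rwa [map_zero] at this

omit [Fintype G] [NeZero (Nat.card G : k)] in
theorem mk_one_smul (m : M) (a : Invariants k R G) :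
    op a • BimodTensor.mk (S := SkewGroupAlgebra R G) (T := Invariants k R G) m (1 : R) =
      BimodTensor.mk (op (invToSkew k R G a) • m) 1 := by
  rw [BimodTensor.mk_op_smul, invToSkew_smul, BimodTensor.smul_mk, inv_op_smul, one_mul, mul_one]

variable [IsNoetherianRing Rᵐᵒᵖ]

/-- The functor `- ⊗_B R` preserves morphisms with torsion kernel and cokernel. -/
theorem isoModTorsion_tensorR_map {M N : ModuleCat.{u} (SkewGroupAlgebra R G)ᵐᵒᵖ} (f : M ⟶ N)
    (hf : isoModTorsion (SkewGroupAlgebra R G) (skewRadical R G) f) :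
    isoModTorsion (Invariants k R G) (invRadical k R G) ((tensorR k R G).map f) := by
  rw [isoModTorsion_iff] at hf ⊢
  refine ⟨fun z hz => ?_, fun z => ?_⟩
  · obtain ⟨m, rfl⟩ := exists_eq_mk_avg_smul k R G (M := M) z
    -- From f(me) ⊗ 1 = 0 follows f(me)e = 0, and e² = e turns this into f(me) = 0.
    have h := smul_eq_zero_of_mk_eq_zero k R G (M := N) (m := f (op (avg k R G) • m)) hz
    change op ((SkewMonoidAlgebra.single 1 1 : SkewGroupAlgebra R G) * avg k R G) •
      f (op (avg k R G) • m) = 0 at h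
    rw [SkewMonoidAlgebra.single_one_one, one_mul, ← map_smul, smul_smul, ← op_mul] at h
    have he : avg k R G * avg k R G = avg k R G := by
      rw [mul_avg, avg_smul_one, SkewMonoidAlgebra.single_one_one, one_mul]
    rw [he] at h
    obtain ⟨n, hn⟩ := hf.1 _ h
    refine ⟨n, fun a ha => ?_⟩
    refine (mk_one_smul k R G (M := M) _ a).trans ?_
    rw [hn _ (invToSkew_mem_pow k R G n ha)]
    exact BimodTensor.mk_zero_left _
  · obtain ⟨m, rfl⟩ := exists_eq_mk_avg_smul k R G (M := N) z
    obtain ⟨n, hn⟩ := hf.2 (op (avg k R G) • m)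
    refine ⟨n, fun a ha => ?_⟩
    obtain ⟨x, hx⟩ := hn _ (invToSkew_mem_pow k R G n ha)
    refine ⟨BimodTensor.mk (M := M) x 1, Eq.trans ?_ (mk_one_smul k R G (M := N) _ a).symm⟩
    exact congrArg (fun y : N => BimodTensor.mk (M := N) y (1 : R)) hx

variable {k R G} in
/-- The functor `Hom_A(R, -)` preserves morphisms with torsion kernel and cokernel.  For the
cokernel no Artin-Rees property is needed: `φ : R → N` composed with the action of `c e d ∈ B`
factors through the projection of `R` onto the free module `A`, so it lifts along `M → N` as soon as
`φ c` takes its values in the image of `M`. -/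
theorem isoModTorsion_homR_map (hcof : Cofinal k R G)
    {M N : ModuleCat.{u} (Invariants k R G)ᵐᵒᵖ} (f : M ⟶ N)
    (hf : isoModTorsion (Invariants k R G) (invRadical k R G) f) :
    isoModTorsion (SkewGroupAlgebra R G) (skewRadical R G) ((homR k R G).map f) := by
  have := finite_invariants_op k R G
  rw [isoModTorsion_iff] at hf ⊢
  refine ⟨fun (φ : BimodHom (SkewGroupAlgebra R G) (Invariants k R G) R M) hφ => ?_,
    fun (φ : BimodHom (SkewGroupAlgebra R G) (Invariants k R G) R N) => ?_⟩
  · have hker : ∀ r : R, f (φ r) = 0 := fun r =>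
      DFunLike.congr_fun (F := BimodHom (SkewGroupAlgebra R G) (Invariants k R G) R N) hφ r
    obtain ⟨n, hn⟩ := exists_pow_forall_smul_mem (I := invRadical k R G)
      (LinearMap.ker φ.toLin) fun r => by
        obtain ⟨n, hn⟩ := hf.1 _ (hker r)
        exact ⟨n, fun s hs => (φ.toLin.map_smul _ _).trans (hn s hs)⟩
    obtain ⟨m, hm⟩ := exists_skewRadical_pow_smul_mem hcof n
    refine ⟨m, fun b hb => ?_⟩
    change op b • φ = 0
    exact BimodHom.ext fun x =>
      hm (LinearMap.ker φ.toLin).toAddSubgroup (fun r a ha => hn r a ha) b hb x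
  · obtain ⟨n, hn⟩ := exists_pow_forall_smul_mem (I := invRadical k R G)
      ((LinearMap.range f.hom).comap φ.toLin) fun r => by
        obtain ⟨n, hn⟩ := hf.2 (φ r)
        refine ⟨n, fun s hs => ?_⟩
        obtain ⟨x, hx⟩ := hn s hs
        exact ⟨x, hx.trans (φ.toLin.map_smul _ _).symm⟩
    obtain ⟨m, hm⟩ := exists_skewRadical_pow_smul_mem hcof n
    have hm := hm ((LinearMap.range f.hom).comap φ.toLin).toAddSubgroup fun r a ha => hn r a ha
    let D : Submodule (SkewGroupAlgebra R G)ᵐᵒᵖ (BimodHom (SkewGroupAlgebra R G)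
      (Invariants k R G) R N) := LinearMap.range ((homR k R G).map f).hom
    -- The first m factors move the values of φ into the image of f; the last one lies in BeB and
    -- makes a lift possible.
    refine ⟨m + 1, fun s hs => ?_⟩
    change op s • φ ∈ D
    rw [Ideal.IsTwoSided.pow_add, Submodule.pow_one] at hs
    induction hs using Submodule.mul_induction_on' with
    | mem_mul_mem b hb b' hb' =>
      refine skewRadical_avg_induction k R G (C := fun b' => op (b * b') • φ ∈ D) hb'
        (fun c d => ?_) fun c d hc hd => ?_
      · obtain ⟨x, hx⟩ := hm b hb (c • (1 : R))
        -- With f(x) = φ(b c · 1), the lift of φ · (b c e d) is r ↦ x ρ(d · r).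
        refine ⟨((LinearMap.toSpanSingleton (Invariants k R G)ᵐᵒᵖ M x).comp
          ({ toFun := fun r => op (reynolds k R G (d • r))
             map_add' := fun r r' => by rw [smul_add, map_add, MulOpposite.op_add]
             map_smul' := fun a r => by rw [smul_comm, map_smul]; rfl } :
            R →ₗ[(Invariants k R G)ᵐᵒᵖ] (Invariants k R G)ᵐᵒᵖ) :
            BimodHom (SkewGroupAlgebra R G) (Invariants k R G) R M), BimodHom.ext fun r => ?_⟩
        change f.hom (op (reynolds k R G (d • r)) • x) = φ ((b * (c * avg k R G * d)) • r)
        rw [map_smul, hx, mul_smul, mul_smul, mul_avg_smul]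
        refine (φ.toLin.map_smul _ _).symm.trans (congrArg φ ?_)
        exact (smul_comm b (op (reynolds k R G (d • r))) (c • (1 : R))).symm
      · rw [mul_add, MulOpposite.op_add, add_smul]
        exact D.add_mem hc hd
    | add a _ b _ ha hb =>
      rw [MulOpposite.op_add, add_smul]
      exact D.add_mem ha hb

/-- The unit `M → Hom_A(R, M ⊗_B R)` has torsion kernel and cokernel. -/
theorem isoModTorsion_unit (M : ModuleCat.{u} (SkewGroupAlgebra R G)ᵐᵒᵖ) :
    isoModTorsion (SkewGroupAlgebra R G) (skewRadical R G)
      ((tensorHomUnit (SkewGroupAlgebra R G) (Invariants k R G) R).app M) := by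
  rw [isoModTorsion_iff]
  refine ⟨fun (m : M) hm => ⟨1, fun b hb => ?_⟩,
    fun (φ : BimodHom (SkewGroupAlgebra R G) (Invariants k R G) R
      (BimodTensor (SkewGroupAlgebra R G) (Invariants k R G) R M)) => ⟨1, fun b hb => ?_⟩⟩
  · rw [Submodule.pow_one] at hb
    refine skewRadical_avg_induction k R G (C := fun b => op b • m = 0) hb (fun c d => ?_)
      fun c d hc hd => ?_
    · have h := smul_eq_zero_of_mk_eq_zero k R G (M := M) (m := m) (p := c • (1 : R))
        (DFunLike.congr_fun (F := BimodHom (SkewGroupAlgebra R G) (Invariants k R G) R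
          (BimodTensor (SkewGroupAlgebra R G) (Invariants k R G) R M)) hm _)
      rw [op_mul, mul_smul, mul_avg, h, smul_zero]
    · rw [MulOpposite.op_add, add_smul, hc, hd, add_zero]
  · rw [Submodule.pow_one] at hb
    let D : Submodule (SkewGroupAlgebra R G)ᵐᵒᵖ (BimodHom (SkewGroupAlgebra R G)
      (Invariants k R G) R (BimodTensor (SkewGroupAlgebra R G) (Invariants k R G) R M)) :=
        LinearMap.range ((tensorHomUnit (SkewGroupAlgebra R G) (Invariants k R G) R).app M).hom
    refine skewRadical_avg_induction k R G (C := fun b => op b • φ ∈ D) hb (fun c d => ?_)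
      fun c d hc hd => ?_
    · obtain ⟨m, hm⟩ := exists_eq_mk_avg_smul k R G (M := M) (φ (c • (1 : R)))
      -- If φ(c · 1) = me ⊗ 1, then φ · (ced) sends r to (me ⊗ 1) ρ(d · r) = me ⊗ (ed · r), which is
      -- the unit at (me)(ed).
      refine ⟨op (avg k R G * d) • op (avg k R G) • m, BimodHom.ext fun r => ?_⟩
      change BimodTensor.mk (M := M) (op (avg k R G * d) • op (avg k R G) • m) r =
        φ ((c * avg k R G * d) • r)
      rw [BimodTensor.mk_op_smul, mul_smul (c * avg k R G), mul_avg_smul, mul_smul]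
      refine Eq.trans ?_ (φ.toLin.map_smul (op (reynolds k R G (d • r))) (c • (1 : R))).symm
      change _ = op (reynolds k R G (d • r)) • φ (c • (1 : R))
      rw [hm, BimodTensor.smul_mk, inv_op_smul, one_mul, coe_reynolds]
    · rw [MulOpposite.op_add, add_smul]
      exact D.add_mem hc hd

omit [IsNoetherianRing Rᵐᵒᵖ] in
/-- The counit `Hom_A(R, N) ⊗_B R → N` is an isomorphism. -/
theorem isIso_counit : IsIso (homTensorCounit (SkewGroupAlgebra R G) (Invariants k R G) R) := by
  suffices ∀ N, IsIso ((homTensorCounit (SkewGroupAlgebra R G) (Invariants k R G) R).app N) from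
    NatIso.isIso_of_isIso_app _
  intro N
  rw [ConcreteCategory.isIso_iff_bijective]
  constructor
  · rw [injective_iff_map_eq_zero]
    intro z hz
    obtain ⟨φ, rfl⟩ := exists_eq_mk_avg_smul k R G
      (M := BimodHom (SkewGroupAlgebra R G) (Invariants k R G) R N) z
    have h : φ (avg k R G • (1 : R)) = 0 := hz
    rw [avg_smul_one] at h
    -- As e · r = 1 ρ(r), the map φe is r ↦ φ(1) ρ(r), hence zero once φ(1) = 0.
    have h0 : op (avg k R G) • φ = 0 := BimodHom.ext fun r => by
      change φ (avg k R G • r) = 0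
      have e : avg k R G • r = op (reynolds k R G r) • (1 : R) := by
        rw [inv_op_smul, one_mul, coe_reynolds]
      rw [e]
      refine (φ.toLin.map_smul _ _).trans ?_
      change _ • φ 1 = 0
      rw [h, smul_zero]
    exact (congrArg (fun ψ : BimodHom (SkewGroupAlgebra R G) (Invariants k R G) R N =>
      BimodTensor.mk (M := BimodHom (SkewGroupAlgebra R G) (Invariants k R G) R N) ψ (1 : R))
      h0).trans (BimodTensor.mk_zero_left _)
  · intro n
    -- The preimage of n is φ ⊗ 1 with φ(r) = n ρ(r), because ρ(1) = 1.
    let φ : BimodHom (SkewGroupAlgebra R G) (Invariants k R G) R N :=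
      (LinearMap.toSpanSingleton (Invariants k R G)ᵐᵒᵖ N n).comp
        ({ toFun := fun r => op (reynolds k R G r)
           map_add' := fun r r' => by rw [map_add, MulOpposite.op_add]
           map_smul' := fun a r => by rw [map_smul]; rfl } :
          R →ₗ[(Invariants k R G)ᵐᵒᵖ] (Invariants k R G)ᵐᵒᵖ)
    refine ⟨BimodTensor.mk φ 1, ?_⟩
    change op (reynolds k R G 1) • n = n
    rw [reynolds_one, op_one, one_smul]

end Functors

end GroupAction

end RightTorsion

end

/-! ### The equivalence of quotient categories -/

theorem mainTheorem2 (k R G : Type u) [Field k] [Ring R] [Algebra k R]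
    [IsNoetherianRing R] [IsNoetherianRing Rᵐᵒᵖ]
    [Group G] [Finite G] [NeZero (Nat.card G : k)]
    [MulSemiringAction G R] [SMulCommClass G k R]
    (hcof : RightTorsion.Cofinal k R G)
    (hAR : RightTorsion.HasRightAR (RightTorsion.Invariants k R G)
      (RightTorsion.invRadical k R G)) :
    ∃ (hHom : (RightTorsion.isoModTorsion (RightTorsion.Invariants k R G)
          (RightTorsion.invRadical k R G)).IsInvertedBy
          (RightTorsion.homR k R G ⋙
            RightTorsion.projQMod (RightTorsion.SkewGroupAlgebra R G)
              (RightTorsion.skewRadical R G)))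
      (hTensor : (RightTorsion.isoModTorsion (RightTorsion.SkewGroupAlgebra R G)
          (RightTorsion.skewRadical R G)).IsInvertedBy
          (RightTorsion.tensorR k R G ⋙
            RightTorsion.projQMod (RightTorsion.Invariants k R G)
              (RightTorsion.invRadical k R G))),
      Nonempty (Localization.Construction.lift _ hHom ⋙ Localization.Construction.lift _ hTensor ≅
        𝟭 (RightTorsion.QMod (RightTorsion.Invariants k R G) (RightTorsion.invRadical k R G))) ∧
      Nonempty (Localization.Construction.lift _ hTensor ⋙ Localization.Construction.lift _ hHom ≅
        𝟭 (RightTorsion.QMod (RightTorsion.SkewGroupAlgebra R G)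
          (RightTorsion.skewRadical R G))) := by
  cases nonempty_fintype G
  have hHom : (RightTorsion.isoModTorsion (RightTorsion.Invariants k R G)
      (RightTorsion.invRadical k R G)).IsInvertedBy (RightTorsion.homR k R G ⋙
        RightTorsion.projQMod (RightTorsion.SkewGroupAlgebra R G) (RightTorsion.skewRadical R G)) :=
    fun _ _ f hf => MorphismProperty.Q_inverts _ _ (RightTorsion.isoModTorsion_homR_map hcof f hf)
  have hTensor : (RightTorsion.isoModTorsion (RightTorsion.SkewGroupAlgebra R G)
      (RightTorsion.skewRadical R G)).IsInvertedBy (RightTorsion.tensorR k R G ⋙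
        RightTorsion.projQMod (RightTorsion.Invariants k R G) (RightTorsion.invRadical k R G)) :=
    fun _ _ f hf => MorphismProperty.Q_inverts _ _
      (RightTorsion.isoModTorsion_tensorR_map k R G f hf)
  have := RightTorsion.isIso_counit k R G
  let unit := Functor.whiskerRight (RightTorsion.tensorHomUnit (RightTorsion.SkewGroupAlgebra R G)
    (RightTorsion.Invariants k R G) R)
    (RightTorsion.projQMod (RightTorsion.SkewGroupAlgebra R G) (RightTorsion.skewRadical R G))
  -- Unlike the counit, the unit is inverted only after projection to the quotient category.
  have : ∀ M, IsIso (unit.app M) := fun M =>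
    MorphismProperty.Q_inverts _ _ (RightTorsion.isoModTorsion_unit k R G M)
  have : IsIso unit := NatIso.isIso_of_isIso_app _
  exact ⟨hHom, hTensor,
    RightTorsion.nonempty_lift_comp_lift_iso hHom hTensor
      (Functor.isoWhiskerRight (asIso (RightTorsion.homTensorCounit _ _ _)) _ ≪≫
        Functor.leftUnitor _),
    RightTorsion.nonempty_lift_comp_lift_iso hTensor hHom
      ((asIso unit).symm ≪≫ Functor.leftUnitor _)⟩
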